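/- Let $R$ be a right noetherian ring and let $\mathrm{Mod}\text{-}R$ be the category of all right $R$-modules and $\mathrm{mod}\text{-}R$ its full subcategory of finitely generated modules. Let $C\in\mathrm{Mod}\text{-}R$ be a $1$-cotilting module, i.e. $\operatorname{Ext}^i_R(C^\alpha,C)=0$ for all $i>0$ and all cardinals $\alpha$, $C$ has injective dimension at most $1$, and there is an exact sequence $0\to C_1\to C_0\to W\to 0$ where $W$ is an injective cogenerator of $\mathrm{Mod}\text{-}R$ and $C_0,C_1$ are direct summands of direct products of copies of $C$. Assume moreover that $C$ is $\Sigma$-pure-injective, i.e. every direct sum of copies of $C$ is pure-injective. Put $$\mathcal Y={}^{\perp}C=\{M\in\mathrm{Mod}\text{-}R\mid \operatorname{Ext}^1_R(M,C)=0\},\qquad \mathcal X=\{X\in\mathrm{Mod}\text{-}R\mid \operatorname{Hom}_R(X,Y)=0\text{ for all }Y\in\mathcal Y\},$$ so that $(\mathcal X,\mathcal Y)$ is the torsion pair cogenerated by $C$, and let $\mathcal X_0=\mathcal X\cap\mathrm{mod}\text{-}R$ and $\mathcal Y_0=\mathcal Y\cap\mathrm{mod}\text{-}R$ be its restriction to $\mathrm{mod}\text{-}R$.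 A torsion pair in $\mathrm{Mod}\text{-}R$ (resp. in $\mathrm{mod}\text{-}R$) is said to split if every module in $\mathrm{Mod}\text{-}R$ (resp. in $\mathrm{mod}\text{-}R$) is the direct sum of a torsion submodule and a torsion-free submodule. Then: 1. $(\mathcal X_0,\mathcal Y_0)$ splits in $\mathrm{mod}\text{-}R$ if and only if $(\mathcal X,\mathcal Y)$ splits in $\mathrm{Mod}\text{-}R$; 2. every module in $\mathcal Y_0$ has projective dimension (over $R$) at most $1$ if and only if every module in $\mathcal Y$ has projective dimension at most $1$. -/

import Mathlib

universe u

open CategoryTheory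

namespace CotiltingTheory

section Modules

variable {S : Type u} [Ring S]

/-- `leftExtPerp U` is the class `^⊥U` of all modules `M` with `Ext¹(M, U) = 0`. -/
def leftExtPerp (U : ModuleCat.{u} S) : ObjectProperty (ModuleCat.{u} S) :=
  fun M => Subsingleton (Abelian.Ext.{u} M U 1)

/-- The class of all modules `X` with `Hom(X, Y) = 0` for all `Y` in `𝒴`. If `𝒴` is a torsion-free
class, this is the torsion class of the torsion pair with torsion-free class `𝒴`. -/
def leftHomPerp (𝒴 : ObjectProperty (ModuleCat.{u} S)) : ObjectProperty (ModuleCat.{u} S) :=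
  fun X => ∀ Y : ModuleCat.{u} S, 𝒴 Y → ∀ f : X ⟶ Y, f = 0

/-- `Prod U`: all direct summands of direct products of copies of `U`. -/
def prodClass (U : ModuleCat.{u} S) : ObjectProperty (ModuleCat.{u} S) :=
  fun M => ∃ ι : Type u, Nonempty (Retract M (ModuleCat.of S (ι → U)))

/-- `1`-cotilting modules. -/
structure IsOneCotilting (U : ModuleCat.{u} S) : Prop where
  ext_prod_eq_zero : ∀ (i : ℕ), 0 < i → ∀ ι : Type u,
    Subsingleton (Abelian.Ext.{u} (ModuleCat.of S (ι → U)) U i)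
  injectiveDimension_le_one : HasInjectiveDimensionLE U 1
  /-- there is an exact sequence `0 → U₁ → U₀ → W → 0` with `U₀`, `U₁` in `Prod U` and `W` an
  injective cogenerator -/
  exists_shortExact : ∃ E : ShortComplex (ModuleCat.{u} S), E.ShortExact ∧
    prodClass U E.X₁ ∧ prodClass U E.X₂ ∧ Injective E.X₃ ∧ IsCoseparator E.X₃

/-- A short exact sequence is pure exact if every morphism from a finitely presented module to its
last term lifts to its middle term. -/
def IsPureExact (E : ShortComplex (ModuleCat.{u} S)) : Prop :=
  E.ShortExact ∧ ∀ F : ModuleCat.{u} S, Module.FinitePresentation S F →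
    ∀ g : F ⟶ E.X₃, ∃ h : F ⟶ E.X₂, h ≫ E.g = g

/-- `U` is pure-injective: it has the extension property along all pure monomorphisms. -/
def IsPureInjective (U : ModuleCat.{u} S) : Prop :=
  ∀ E : ShortComplex (ModuleCat.{u} S), IsPureExact E →
    ∀ φ : E.X₁ ⟶ U, ∃ ψ : E.X₂ ⟶ U, E.f ≫ ψ = φ

/-- `U` is `Σ`-pure-injective: every direct sum of copies of `U` is pure-injective. -/
def IsSigmaPureInjective (U : ModuleCat.{u} S) : Prop :=
  ∀ ι : Type u, IsPureInjective (ModuleCat.of S (ι →₀ U))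

variable (S) in
/-- The class of finitely generated modules. -/
def finitelyGenerated : ObjectProperty (ModuleCat.{u} S) :=
  fun M => Module.Finite S M

/-- A torsion pair `(𝒳, 𝒴)` in the full subcategory `𝒜` splits if every object of `𝒜` is the
(internal) direct sum of a submodule in `𝒳` and a submodule in `𝒴`. -/
def SplitsIn (𝒜 𝒳 𝒴 : ObjectProperty (ModuleCat.{u} S)) : Prop :=
  ∀ M : ModuleCat.{u} S, 𝒜 M → ∃ X Y : Submodule S M,
    IsCompl X Y ∧ 𝒳 (ModuleCat.of S X) ∧ 𝒴 (ModuleCat.of S Y)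

/-- Every module in the class `𝒴` has projective dimension at most `1`. -/
def ProjDimLEOne (𝒴 : ObjectProperty (ModuleCat.{u} S)) : Prop :=
  ∀ M : ModuleCat.{u} S, 𝒴 M → HasProjectiveDimensionLE M 1

end Modules

end CotiltingTheory

/-! Call modules in `^⊥C` torsion-free and modules without nonzero maps to `C` torsion. Both
equivalences rest on one statement, `IsOneCotilting.extZero_of_forall_finite`: for any `N`, if
`Ext¹(P, N) = 0` for all finitely generated torsion-free `P`, then `Ext¹(M, N) = 0` for all
torsion-free `M`.

This is an Eklof-type argument: `M` is exhausted by submodules `D` with `M / D` torsion-free, along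
which lifts extend. At limits, torsion-freeness of the quotient survives because pure-injectivity of
`C` makes it testable on finitely generated submodules (`extZero_quotient_sSup`). At successors, `M
/ D` needs a nonzero finitely generated submodule with torsion-free quotient
(`IsOneCotilting.exists_fg_extZero_quotient`). Here `Σ`-pure-injectivity enters, through a chain
condition on `Hom(-, C)` (`IsSigmaPureInjective.exists_forall_extends`) which forces the torsion
part of `M / F` to be finitely generated for `F` finitely generated.

For splitting, the finitely generated case gives `Ext¹(P, T) = 0` for finitely generated
torsion-free `P` and torsion `T`. Torsion modules are directed unions of finitely generated torsion
ones, so `T` may be replaced by any torsion `X`; the key statement with `N = X` then removes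
finiteness of `P`. For projective dimension, `Ext²(M, N) = Ext¹(M, Q)` for a cosyzygy `Q` of `N`,
and the key statement applies to `Q`. -/

namespace CotiltingTheory

/-! ### Vanishing of `Ext¹` as a lifting property -/

section ExtZero

variable {S : Type u} [Ring S]

variable (S) in
/-- Every linear map from `Y` to the last term of a short exact sequence starting in `M` lifts to
the middle term. This is a concrete form of `Ext¹(Y, M) = 0`. -/
def ExtZero (Y M : Type u) [AddCommGroup Y] [Module S Y] [AddCommGroup M] [Module S M] : Prop :=
  ∀ ⦃E Q : Type u⦄ [AddCommGroup E] [AddCommGroup Q] [Module S E] [Module S Q]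
    (f : M →ₗ[S] E) (g : E →ₗ[S] Q), Function.Injective f → Function.Surjective g →
    Function.Exact f g → ∀ h : Y →ₗ[S] Q, ∃ k : Y →ₗ[S] E, g ∘ₗ k = h

variable {Y M I Q : Type u} [AddCommGroup Y] [Module S Y] [AddCommGroup M] [Module S M]
  [AddCommGroup I] [Module S I] [AddCommGroup Q] [Module S Q]

lemma exists_factor {A B P : Type u} [AddCommGroup A] [Module S A] [AddCommGroup B] [Module S B]
    [AddCommGroup P] [Module S P] {p : A →ₗ[S] P} (hp : Function.Surjective p) (f : A →ₗ[S] B)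
    (h : LinearMap.ker p ≤ LinearMap.ker f) : ∃ q : P →ₗ[S] B, ∀ x, q (p x) = f x := by
  refine ⟨(LinearMap.ker p).liftQ f h ∘ₗ
    (p.quotKerEquivOfSurjective hp).symm.toLinearMap, fun x => ?_⟩
  have : (p.quotKerEquivOfSurjective hp).symm (p x) = Submodule.Quotient.mk x := by
    rw [LinearEquiv.symm_apply_eq]; rfl
  simp [this]

/-- A single injective embedding suffices as a test: any extension `E'` of `Q'` by `M` is the
pullback of `I → Q` along an induced map `q : Q' → Q`, so lifting `h'` to `E'` amounts to lifting `q
∘ h'` to `I`. -/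
lemma extZero_of_injective [Module.Injective S I] {f : M →ₗ[S] I} {g : I →ₗ[S] Q}
    (hf : Function.Injective f) (hfg : Function.Exact f g)
    (H : ∀ h : Y →ₗ[S] Q, ∃ k : Y →ₗ[S] I, g ∘ₗ k = h) : ExtZero S Y M := by
  intro E' Q' _ _ _ _ f' g' hf' hg' hfg' h'
  obtain ⟨e, he⟩ := Module.Injective.out f' hf' f
  have hker : LinearMap.ker g' ≤ LinearMap.ker (g ∘ₗ e) := by
    intro x hx
    obtain ⟨m, rfl⟩ := (hfg' x).1 hx
    simp [he, hfg.apply_apply_eq_zero]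
  obtain ⟨q, hq⟩ := exists_factor hg' (g ∘ₗ e) hker
  simp only [LinearMap.comp_apply] at hq
  obtain ⟨k, hk⟩ := H (q ∘ₗ h')
  have hinj : Function.Injective (e.prod g') := by
    rw [injective_iff_map_eq_zero]
    intro d hd
    replace hd : e d = 0 ∧ g' d = 0 := Prod.mk_eq_zero.1 hd
    obtain ⟨m, rfl⟩ := (hfg' d).1 hd.2
    rw [he] at hd
    rw [(map_eq_zero_iff f hf).1 hd.1, map_zero]
  -- The image of `E'` in `I × Q'` is the whole fibre product over `Q`.
  have hmem : ∀ y, k.prod h' y ∈ LinearMap.range (e.prod g') := by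
    intro y
    obtain ⟨e₀, he₀⟩ := hg' (h' y)
    have h1 : g (k y - e e₀) = 0 := by
      have := LinearMap.congr_fun hk y
      simp only [LinearMap.comp_apply] at this
      rw [map_sub, this, ← hq, he₀, sub_self]
    obtain ⟨m, hm⟩ := (hfg _).1 h1
    refine ⟨e₀ + f' m, ?_⟩
    exact Prod.ext (by simp [he, hm]) (by simp [he₀, hfg'.apply_apply_eq_zero])
  refine ⟨(LinearEquiv.ofInjective _ hinj).symm.toLinearMap ∘ₗ
    (k.prod h').codRestrict _ hmem, ?_⟩
  ext y
  exact congrArg (fun x => x.1.2) ((LinearEquiv.ofInjective _ hinj).apply_symm_apply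
    ((k.prod h').codRestrict _ hmem y))

variable (S M) in
lemma exists_injective_embedding : ∃ (I Q : Type u) (_ : AddCommGroup I) (_ : AddCommGroup Q)
    (_ : Module S I) (_ : Module S Q) (f : M →ₗ[S] I) (g : I →ₗ[S] Q), Module.Injective S I ∧
    Function.Injective f ∧ Function.Surjective g ∧ Function.Exact f g := by
  let I := CategoryTheory.Injective.under (ModuleCat.of S M)
  let f := (CategoryTheory.Injective.ι (ModuleCat.of S M)).hom
  refine ⟨I, I ⧸ LinearMap.range f, inferInstance, inferInstance, inferInstance, inferInstance,
    f, (LinearMap.range f).mkQ, ?_, ?_, Submodule.mkQ_surjective _, f.exact_map_mkQ_range⟩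
  · have : CategoryTheory.Injective (ModuleCat.of S I) :=
      inferInstanceAs (CategoryTheory.Injective (CategoryTheory.Injective.under _))
    exact Module.injective_module_of_injective_object S I
  · exact (ModuleCat.mono_iff_injective _).1 inferInstance

/-- The short complex of modules attached to an exact pair of linear maps. -/
abbrev complexOf {f : M →ₗ[S] I} {g : I →ₗ[S] Q} (hfg : Function.Exact f g) :
    ShortComplex (ModuleCat.{u} S) :=
  ShortComplex.mk (ModuleCat.ofHom f) (ModuleCat.ofHom g) (by
    ext x; simp [hfg.apply_apply_eq_zero])

lemma complexOf_shortExact {f : M →ₗ[S] I} {g : I →ₗ[S] Q} (hf : Function.Injective f)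
    (hg : Function.Surjective g) (hfg : Function.Exact f g) : (complexOf hfg).ShortExact :=
  ModuleCat.shortComplex_shortExact _ hfg hf hg

lemma subsingleton_ext_iff (Y M : ModuleCat.{u} S) :
    Subsingleton (Abelian.Ext.{u} Y M 1) ↔ ExtZero S Y M := by
  constructor
  · intro _ E Q _ _ _ _ f g hf hg hfg h
    have hE := complexOf_shortExact hf hg hfg
    obtain ⟨x, hx⟩ := Abelian.Ext.covariant_sequence_exact₃ Y hE
      (Abelian.Ext.mk₀ (ModuleCat.ofHom h)) (zero_add 1)
      (Subsingleton.elim (α := Abelian.Ext Y M 1) _ _)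
    obtain ⟨k, rfl⟩ := Abelian.Ext.addEquiv₀.symm.surjective x
    have hk : k ≫ ModuleCat.ofHom g = ModuleCat.ofHom h := by
      apply Abelian.Ext.addEquiv₀.symm.injective
      simpa using hx
    refine ⟨k.hom, ?_⟩
    ext y
    simpa using ConcreteCategory.congr_hom hk y
  · intro H
    obtain ⟨I, Q, _, _, _, _, f, g, hI, hf, hg, hfg⟩ := exists_injective_embedding S M
    have hE := complexOf_shortExact hf hg hfg
    have : CategoryTheory.Injective (ModuleCat.of S I) :=
      Module.injective_object_of_injective_module S I
    refine subsingleton_of_forall_eq 0 fun x => ?_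
    obtain ⟨y, rfl⟩ := Abelian.Ext.covariant_sequence_exact₁ Y hE x
      (Abelian.Ext.eq_zero_of_injective (I := ModuleCat.of S I) (n := 0) _) (zero_add 1)
    obtain ⟨h, rfl⟩ := Abelian.Ext.addEquiv₀.symm.surjective y
    obtain ⟨k, hk⟩ := H f g hf hg hfg h.hom
    obtain rfl : ModuleCat.ofHom k ≫ (complexOf hfg).g = h := by
      ext y; simp [← hk]
    rw [Abelian.Ext.addEquiv₀_symm_apply, ← Abelian.Ext.mk₀_comp_mk₀]
    rw [Abelian.Ext.comp_assoc_of_second_deg_zero, hE.comp_extClass, Abelian.Ext.comp_zero]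

/-- Dimension shifting: `Ext²(Y, N)` is `Ext¹(Y, Q)` for a cosyzygy `Q` of `N`. -/
lemma hasProjectiveDimensionLE_one_iff (Y : ModuleCat.{u} S) :
    HasProjectiveDimensionLE Y 1 ↔ ∀ (N I Q : Type u) [AddCommGroup N] [Module S N]
      [AddCommGroup I] [Module S I] [AddCommGroup Q] [Module S Q] (f : N →ₗ[S] I) (g : I →ₗ[S] Q),
      Module.Injective S I → Function.Injective f → Function.Surjective g →
      Function.Exact f g → ExtZero S Y Q := by
  constructor
  · intro _ N I Q _ _ _ _ _ _ f g hI hf hg hfg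
    have hE := complexOf_shortExact hf hg hfg
    have : CategoryTheory.Injective (ModuleCat.of S I) :=
      Module.injective_object_of_injective_module S I
    rw [← subsingleton_ext_iff Y (ModuleCat.of S Q)]
    refine subsingleton_of_forall_eq 0 fun x => ?_
    obtain ⟨y, rfl⟩ := Abelian.Ext.covariant_sequence_exact₃ Y hE x (n₁ := 2) rfl
      (Abelian.Ext.eq_zero_of_hasProjectiveDimensionLT _ 2 le_rfl)
    rw [Abelian.Ext.eq_zero_of_injective (I := ModuleCat.of S I) (n := 0) y, Abelian.Ext.zero_comp]
  · intro H
    refine hasProjectiveDimensionLT_of_enoughInjectives Y 2 fun N => ?_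
    obtain ⟨I, Q, _, _, _, _, f, g, hI, hf, hg, hfg⟩ := exists_injective_embedding S N
    have hE := complexOf_shortExact hf hg hfg
    have : CategoryTheory.Injective (ModuleCat.of S I) :=
      Module.injective_object_of_injective_module S I
    refine subsingleton_of_forall_eq 0 fun x => ?_
    obtain ⟨y, rfl⟩ := Abelian.Ext.covariant_sequence_exact₁ Y hE x
      (Abelian.Ext.eq_zero_of_injective (I := ModuleCat.of S I) (n := 1) _) (n₀ := 1) rfl
    have := (subsingleton_ext_iff Y (ModuleCat.of S Q)).2 (H N I Q f g hI hf hg hfg)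
    rw [Subsingleton.elim (α := Abelian.Ext Y (ModuleCat.of S Q) 1) y 0, Abelian.Ext.zero_comp]

/-- A partial lift on a submodule `N` extends along `N ≤ N'` when `Ext¹(N' / N, M) = 0`. -/
lemma ExtZero.exists_extend [Module.Injective S I] {Y' : Type u} [AddCommGroup Y'] [Module S Y']
    {P : Type u} [AddCommGroup P] [Module S P]
    {f : M →ₗ[S] I} {g : I →ₗ[S] Q} (hf : Function.Injective f) (hg : Function.Surjective g)
    (hfg : Function.Exact f g) {i : Y' →ₗ[S] Y} {p : Y →ₗ[S] P} (hi : Function.Injective i)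
    (hp : Function.Surjective p) (hip : Function.Exact i p) (H : ExtZero S P M)
    (h : Y →ₗ[S] Q) (k : Y' →ₗ[S] I) (hk : g ∘ₗ k = h ∘ₗ i) :
    ∃ l : Y →ₗ[S] I, g ∘ₗ l = h ∧ l ∘ₗ i = k := by
  obtain ⟨l₀, hl₀⟩ := Module.Injective.out i hi k
  have hker : LinearMap.ker p ≤ LinearMap.ker (h - g ∘ₗ l₀) := by
    intro x hx
    obtain ⟨y, rfl⟩ := (hip x).1 hx
    have := LinearMap.congr_fun hk y
    simp only [LinearMap.comp_apply] at this
    simp [hl₀, this]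
  obtain ⟨q, hq⟩ := exists_factor hp _ hker
  obtain ⟨r, hr⟩ := H f g hf hg hfg q
  refine ⟨l₀ + r ∘ₗ p, ?_, ?_⟩
  · ext x
    have := LinearMap.congr_fun hr (p x)
    simp only [LinearMap.comp_apply] at this
    simp [this, hq]
  · ext y
    simp [hl₀, hip.apply_apply_eq_zero]

lemma ExtZero.of_exact {Y' P : Type u} [AddCommGroup Y'] [Module S Y']
    [AddCommGroup P] [Module S P] {i : Y' →ₗ[S] Y} {p : Y →ₗ[S] P} (hi : Function.Injective i)
    (hp : Function.Surjective p) (hip : Function.Exact i p) (H' : ExtZero S Y' M)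
    (H : ExtZero S P M) : ExtZero S Y M := by
  obtain ⟨I, Q, _, _, _, _, f, g, hI, hf, hg, hfg⟩ := exists_injective_embedding S M
  refine extZero_of_injective hf hfg fun h => ?_
  obtain ⟨k, hk⟩ := H' f g hf hg hfg (h ∘ₗ i)
  obtain ⟨l, hl, -⟩ := H.exists_extend hf hg hfg hi hp hip h k hk
  exact ⟨l, hl⟩

lemma ExtZero.of_linearEquiv {Y' : Type u} [AddCommGroup Y'] [Module S Y'] (e : Y ≃ₗ[S] Y')
    (H : ExtZero S Y M) : ExtZero S Y' M := by
  intro E Q _ _ _ _ f g hf hg hfg h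
  obtain ⟨k, hk⟩ := H f g hf hg hfg (h ∘ₗ e.toLinearMap)
  refine ⟨k ∘ₗ e.symm.toLinearMap, ?_⟩
  ext y
  simpa using LinearMap.congr_fun hk (e.symm y)

/-- If `U` has injective dimension at most one, then `^⊥U` is closed under submodules. -/
lemma ExtZero.of_mono {U : ModuleCat.{u} S} [HasInjectiveDimensionLE U 1] {Y' : Type u}
    [AddCommGroup Y'] [Module S Y'] {i : Y' →ₗ[S] Y} (hi : Function.Injective i)
    (H : ExtZero S Y U) : ExtZero S Y' U := by
  obtain ⟨I, Q, _, _, _, _, f, g, hI, hf, hg, hfg⟩ := exists_injective_embedding S U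
  have hE := complexOf_shortExact hf hg hfg
  have : CategoryTheory.Injective (ModuleCat.of S I) :=
    Module.injective_object_of_injective_module S I
  -- The cosyzygy `Q` is itself injective, so `h` extends from `Y'` to `Y`.
  have := (hE.hasInjectiveDimensionLT_X₃_iff 0 this).2
    (inferInstanceAs (HasInjectiveDimensionLE U 1))
  have : CategoryTheory.Injective (ModuleCat.of S Q) :=
    injective_iff_hasInjectiveDimensionLT_one.2 this
  have := Module.injective_module_of_injective_object S Q
  refine extZero_of_injective hf hfg fun h => ?_
  obtain ⟨h', hh'⟩ := Module.Injective.out i hi h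
  obtain ⟨k, hk⟩ := H f g hf hg hfg h'
  refine ⟨k ∘ₗ i, ?_⟩
  ext y
  simpa [hh'] using LinearMap.congr_fun hk (i y)

/-- `Ext¹(Y, M) = 0` if every extension of `Y` by `M` splits. -/
lemma extZero_of_splits (H : ∀ (E : Type u) [AddCommGroup E] [Module S E] (f : M →ₗ[S] E)
    (g : E →ₗ[S] Y), Function.Injective f → Function.Surjective g → Function.Exact f g →
    ∃ s : Y →ₗ[S] E, g ∘ₗ s = LinearMap.id) : ExtZero S Y M := by
  intro E Q _ _ _ _ f g hf hg hfg h
  -- The pullback of `E → Q` along `h` is an extension of `Y` by `M`; a section of it yields the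
  -- lift.
  let P := LinearMap.eqLocus (g ∘ₗ LinearMap.fst S E Y) (h ∘ₗ LinearMap.snd S E Y)
  have hP : ∀ x : P, g x.1.1 = h x.1.2 := fun x => x.2
  let i : M →ₗ[S] P := (LinearMap.inl S E Y ∘ₗ f).codRestrict P fun m => by
    simp [P, LinearMap.mem_eqLocus, hfg.apply_apply_eq_zero]
  have hi : Function.Injective i := by
    intro a b hab
    have := congrArg (fun x : P => x.1.1) hab
    exact hf this
  have hp : Function.Surjective (LinearMap.snd S E Y ∘ₗ P.subtype) := by
    intro y
    obtain ⟨e, he⟩ := hg (h y)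
    exact ⟨⟨(e, y), he⟩, rfl⟩
  have hip : Function.Exact i (LinearMap.snd S E Y ∘ₗ P.subtype) := by
    rintro ⟨⟨e, y⟩, hx⟩
    constructor
    · intro hy
      obtain rfl : y = 0 := hy
      have hx' : g e = 0 := by simpa [P, LinearMap.mem_eqLocus] using hx
      obtain ⟨m, rfl⟩ := (hfg _).1 hx'
      exact ⟨m, rfl⟩
    · rintro ⟨m, hm⟩
      exact (congrArg (fun x : P => x.1.2) hm).symm
  obtain ⟨s, hs⟩ := H P i _ hi hp hip
  refine ⟨LinearMap.fst S E Y ∘ₗ P.subtype ∘ₗ s, ?_⟩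
  ext y
  exact (hP (s y)).trans (congrArg h (LinearMap.congr_fun hs y))

end ExtZero

/-! ### The torsion pair cogenerated by `C` -/

section TorsionPair

variable {S : Type u} [Ring S]

variable {Y M : Type u} [AddCommGroup Y] [Module S Y] [AddCommGroup M] [Module S M]

lemma exists_fg_map_eq {p : M →ₗ[S] Y} (hp : Function.Surjective p) {P : Submodule S Y}
    (hP : P.FG) : ∃ V : Submodule S M, V.FG ∧ V.map p = P := by
  obtain ⟨t, ht, rfl⟩ := Submodule.fg_def.1 hP
  refine ⟨Submodule.span S (Function.surjInv hp '' t), Submodule.fg_span (ht.image _), ?_⟩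
  rw [Submodule.map_span, Set.image_image]
  simp [Function.surjInv_eq hp]

lemma ExtZero.pi {U : Type u} [AddCommGroup U] [Module S U] (H : ExtZero S Y U) (ι : Type u) :
    ExtZero S Y (ι → U) := by
  obtain ⟨I, Q, _, _, _, _, f, g, hI, hf, hg, hfg⟩ := exists_injective_embedding S U
  refine extZero_of_injective (I := ι → I) (Q := ι → Q) (f := f.compLeft ι) (g := g.compLeft ι)
    (fun a b hab => ?_) (fun x => ⟨fun hx => ?_, ?_⟩) fun h => ?_
  · exact funext fun i => hf (congrFun hab i)
  · choose m hm using fun i => (hfg (x i)).1 (congrFun hx i)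
    exact ⟨m, funext hm⟩
  · rintro ⟨m, rfl⟩
    exact funext fun i => hfg.apply_apply_eq_zero _
  · choose k hk using fun i => H f g hf hg hfg (LinearMap.proj i ∘ₗ h)
    refine ⟨LinearMap.pi k, ?_⟩
    ext y i
    exact LinearMap.congr_fun (hk i) y

lemma ExtZero.of_retract {U U' : ModuleCat.{u} S} (r : Retract U' U) (H : ExtZero S Y U) :
    ExtZero S Y U' := by
  have := (subsingleton_ext_iff (ModuleCat.of S Y) U).2 H
  refine (subsingleton_ext_iff (ModuleCat.of S Y) U').1 (subsingleton_of_forall_eq 0 fun x => ?_)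
  have hx : x = (x.comp (Abelian.Ext.mk₀ r.i) (add_zero 1)).comp (Abelian.Ext.mk₀ r.r)
      (add_zero 1) := by
    rw [Abelian.Ext.comp_assoc_of_third_deg_zero, Abelian.Ext.mk₀_comp_mk₀, r.retract,
      Abelian.Ext.comp_mk₀_id]
  rw [hx, Subsingleton.elim (x.comp (Abelian.Ext.mk₀ r.i) (add_zero 1)) 0, Abelian.Ext.zero_comp]

variable {C : ModuleCat.{u} S}

/-- For a `1`-cotilting module `C`, the class `^⊥C` is cogenerated by `C`. -/
lemma IsOneCotilting.exists_hom_ne_zero (hC : IsOneCotilting C) (H : ExtZero S M C) {m : M}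
    (hm : m ≠ 0) : ∃ f : M →ₗ[S] C, f m ≠ 0 := by
  obtain ⟨E, hE, ⟨ι, ⟨r⟩⟩, ⟨κ, ⟨r'⟩⟩, -, hW⟩ := hC.exists_shortExact
  obtain ⟨w, hw⟩ : ∃ w : M →ₗ[S] E.X₃, w m ≠ 0 := by
    by_contra! hcon
    have : ModuleCat.ofHom (LinearMap.toSpanSingleton S M m) = 0 :=
      hW.def _ _ fun h => by
        ext
        simpa using hcon h.hom
    apply hm
    simpa using ConcreteCategory.congr_hom this (1 : S)
  -- A map to the cogenerator `W` that is nonzero at `m` lifts to `U₀`, which embeds in a power of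
  -- `C`; some coordinate is then nonzero at `m`.
  have H' : ExtZero S M E.X₁ := (H.pi ι).of_retract r
  obtain ⟨k, hk⟩ := H' E.f.hom E.g.hom hE.moduleCat_injective_f hE.moduleCat_surjective_g
    ((ShortComplex.ShortExact.moduleCat_exact_iff_function_exact _).1 hE.exact) w
  by_contra! hcon
  have h0 : r'.i (k m) = 0 := by
    funext i
    exact hcon (LinearMap.proj i ∘ₗ r'.i.hom ∘ₗ k)
  have hk0 : k m = 0 :=
    (ConcreteCategory.congr_hom r'.retract (k m)).symm.trans ((congrArg r'.r h0).trans (map_zero _))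
  apply hw
  rw [← hk]
  simp [hk0]

/-- Such an `M` embeds in the power of `C` indexed by `Hom(M, C)`, and `^⊥C` is closed under
submodules. -/
lemma IsOneCotilting.extZero_of_forall_exists (hC : IsOneCotilting C)
    (H : ∀ m : M, m ≠ 0 → ∃ f : M →ₗ[S] C, f m ≠ 0) : ExtZero S M C := by
  have := hC.injectiveDimension_le_one
  have h := (subsingleton_ext_iff _ _).1 (hC.ext_prod_eq_zero 1 one_pos (M →ₗ[S] C))
  refine h.of_mono (i := LinearMap.pi fun f => f) ((injective_iff_map_eq_zero _).2 fun m hm => ?_)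
  by_contra hm'
  obtain ⟨f, hf⟩ := H m hm'
  exact hf (congrFun hm f)

variable (C M) in
/-- `M` has no nonzero maps to `C`. -/
def HomZero : Prop := ∀ f : M →ₗ[S] C, f = 0

lemma HomZero.of_surjective (H : HomZero M C) {p : M →ₗ[S] Y} (hp : Function.Surjective p) :
    HomZero Y C := fun f => by
  ext y
  obtain ⟨m, rfl⟩ := hp y
  exact LinearMap.congr_fun (H (f ∘ₗ p)) m

lemma HomZero.of_extension {A B : Type u} [AddCommGroup A] [Module S A] [AddCommGroup B]
    [Module S B] (HA : HomZero A C) (HB : HomZero B C) {i : A →ₗ[S] M} {p : M →ₗ[S] B}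
    (hp : Function.Surjective p) (h : LinearMap.ker p ≤ LinearMap.range i) : HomZero M C := by
  intro f
  have hker : LinearMap.ker p ≤ LinearMap.ker f := fun x hx => by
    obtain ⟨a, rfl⟩ := h hx
    exact LinearMap.congr_fun (HA (f ∘ₗ i)) a
  obtain ⟨q, hq⟩ := exists_factor hp f hker
  ext x
  rw [← hq, HB q]
  rfl

lemma HomZero.eq_zero {X : Type u} [AddCommGroup X] [Module S X] (hC : IsOneCotilting C)
    (hX : HomZero X C) (hY : ExtZero S Y C) (f : X →ₗ[S] Y) : f = 0 := by
  ext x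
  by_contra hx
  obtain ⟨k, hk⟩ := hC.exists_hom_ne_zero hY hx
  exact hk (LinearMap.congr_fun (hX (k ∘ₗ f)) x)

lemma IsOneCotilting.leftHomPerp_iff (hC : IsOneCotilting C) (X : ModuleCat.{u} S) :
    leftHomPerp (leftExtPerp C) X ↔ HomZero X C := by
  constructor
  · intro h f
    have h1 : leftExtPerp C C := (subsingleton_ext_iff _ _).2
      (hC.extZero_of_forall_exists fun m hm => ⟨LinearMap.id, hm⟩)
    exact congrArg ModuleCat.Hom.hom (h C h1 (ModuleCat.ofHom f))
  · intro h Y hY f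
    exact ModuleCat.hom_ext (h.eq_zero hC ((subsingleton_ext_iff _ _).1 hY) f.hom)

lemma IsOneCotilting.subsingleton (hC : IsOneCotilting C) (h : ExtZero S M C)
    (h' : HomZero M C) : Subsingleton M := by
  refine subsingleton_of_forall_eq 0 fun m => ?_
  by_contra hm
  obtain ⟨f, hf⟩ := hC.exists_hom_ne_zero h hm
  exact hf (by simp [h' f])

variable (M C) in
/-- The torsion submodule: the common kernel of all maps to `C`. -/
def reject : Submodule S M := ⨅ f : M →ₗ[S] C, LinearMap.ker f

lemma apply_eq_zero_of_mem_reject {x : M} (hx : x ∈ reject M C) (f : M →ₗ[S] C) : f x = 0 :=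
  (Submodule.mem_iInf _).1 hx f

lemma IsOneCotilting.extZero_quotient_reject (hC : IsOneCotilting C) :
    ExtZero S (M ⧸ reject M C) C := by
  refine hC.extZero_of_forall_exists fun x hx => ?_
  obtain ⟨m, rfl⟩ := Submodule.mkQ_surjective _ x
  by_contra! hcon
  refine hx ((Submodule.Quotient.mk_eq_zero _).2 ((Submodule.mem_iInf _).2 fun f => ?_))
  exact hcon ((reject M C).liftQ f fun y hy => apply_eq_zero_of_mem_reject hy f)

/-- For `f : K → C` on the torsion submodule `K`, the quotient `M / ker f` is an extension of `M /
K` by a submodule of `C`, hence cogenerated by `C`. Maps from `M` to `C` kill `K`, so `K ≤ ker f`.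
-/
lemma IsOneCotilting.homZero_reject (hC : IsOneCotilting C) : HomZero (reject M C) C := by
  have := hC.injectiveDimension_le_one
  intro f
  let K := reject M C
  let N := (LinearMap.ker f).map K.subtype
  have hNK : N ≤ K := Submodule.map_subtype_le _ _
  have h1 : ExtZero S (K ⧸ LinearMap.ker f) C :=
    (hC.extZero_of_forall_exists fun m hm => ⟨LinearMap.id, hm⟩ : ExtZero S C C).of_mono
      (i := (LinearMap.ker f).liftQ f le_rfl) (by
        rw [← LinearMap.ker_eq_bot, Submodule.ker_liftQ_eq_bot _ _ _ le_rfl])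
  have h2 : ExtZero S (M ⧸ N) C := by
    refine ExtZero.of_exact (i := (LinearMap.ker f).mapQ N K.subtype
      (Submodule.le_comap_map _ _)) (p := Submodule.factor hNK) ?_ ?_ ?_ h1
      hC.extZero_quotient_reject
    · rw [injective_iff_map_eq_zero]
      intro x hx
      obtain ⟨x, rfl⟩ := Submodule.mkQ_surjective _ x
      obtain ⟨y, hy, hxy⟩ := (Submodule.Quotient.mk_eq_zero _).1 hx
      obtain rfl : y = x := Subtype.ext hxy
      exact (Submodule.Quotient.mk_eq_zero _).2 hy
    · exact Submodule.factor_surjective hNK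
    · intro x
      obtain ⟨x, rfl⟩ := Submodule.mkQ_surjective _ x
      constructor
      · intro hx
        have hx' : x ∈ K := (Submodule.Quotient.mk_eq_zero _).1 hx
        exact ⟨Submodule.Quotient.mk ⟨x, hx'⟩, rfl⟩
      · rintro ⟨y, hy⟩
        obtain ⟨y, rfl⟩ := Submodule.mkQ_surjective _ y
        rw [← hy]
        exact (Submodule.Quotient.mk_eq_zero _).2 y.2
  ext x
  by_contra hx
  have hx' : N.mkQ x ≠ 0 := by
    intro h
    obtain ⟨y, hy, hxy⟩ := (Submodule.Quotient.mk_eq_zero _).1 h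
    obtain rfl : y = x := Subtype.ext hxy
    exact hx hy
  obtain ⟨g, hg⟩ := hC.exists_hom_ne_zero h2 hx'
  exact hg (apply_eq_zero_of_mem_reject x.2 (g ∘ₗ N.mkQ))

end TorsionPair

/-! ### Testing torsion-freeness on finitely generated submodules -/

section Local

variable {S : Type u} [Ring S] {C : ModuleCat.{u} S}
  {Y M : Type u} [AddCommGroup Y] [Module S Y] [AddCommGroup M] [Module S M]

/-- For a pure-injective module `C`, membership in `^⊥C` can be tested on finitely generated
submodules. -/
lemma extZero_of_forall_fg (hC : IsPureInjective C)
    (H : ∀ P : Submodule S M, P.FG → ExtZero S P C) : ExtZero S M C := by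
  refine extZero_of_splits fun E _ _ f g hf hg hfg => ?_
  -- The extension is pure: a map from a finitely presented module has finitely generated image,
  -- over which the extension splits. Pure-injectivity then extends `𝟙 C` to a retraction.
  obtain ⟨ψ, hψ⟩ := hC (complexOf hfg) ⟨complexOf_shortExact hf hg hfg, fun F hF h => by
    obtain ⟨k, hk⟩ := H (LinearMap.range h.hom) (Submodule.fg_range _) f g hf hg hfg
      (Submodule.subtype _)
    refine ⟨ModuleCat.ofHom (k ∘ₗ h.hom.rangeRestrict), ?_⟩
    ext x
    exact LinearMap.congr_fun hk (h.hom.rangeRestrict x)⟩ (𝟙 C)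
  refine ((Function.Exact.split_tfae hfg hf hg).out 0 1 rfl rfl).2 ⟨ψ.hom, ?_⟩
  ext x
  exact ConcreteCategory.congr_hom hψ x

/-- A finitely generated submodule of `M / sSup c`, the image of some `V`, already embeds in `M / N`
for one `N ∈ c`, since `V ⊓ sSup c` is finitely generated and so lies in some `N`. -/
lemma extZero_quotient_sSup [IsNoetherianRing S] [HasInjectiveDimensionLE C 1]
    (hC : IsPureInjective C) {c : Set (Submodule S M)} (hne : c.Nonempty)
    (hdir : DirectedOn (· ≤ ·) c) (H : ∀ N ∈ c, ExtZero S (M ⧸ N) C) :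
    ExtZero S (M ⧸ sSup c) C := by
  refine extZero_of_forall_fg hC fun P hP => ?_
  obtain ⟨V, hV, rfl⟩ := exists_fg_map_eq (Submodule.mkQ_surjective _) hP
  have : IsNoetherian S V := isNoetherian_of_fg_of_noetherian V hV
  have hVN : (V ⊓ sSup c).FG := by
    rw [← Submodule.map_comap_subtype]
    exact (IsNoetherian.noetherian _).map _
  obtain ⟨N, hN, hVN'⟩ : ∃ N ∈ c, V ⊓ sSup c ≤ N :=
    (CompleteLattice.isCompactElement_iff_le_of_directed_sSup_le _ _).1
      ((Submodule.fg_iff_compact _).1 hVN) c hne hdir inf_le_right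
  let q : V →ₗ[S] M ⧸ N := N.mkQ ∘ₗ V.subtype
  let r := (sSup c).mkQ.submoduleMap V
  have hr : Function.Surjective r := LinearMap.submoduleMap_surjective _ _
  have hker : LinearMap.ker r = LinearMap.ker q := by
    ext x
    have h1 : x ∈ LinearMap.ker r ↔ (x : M) ∈ sSup c := by
      rw [LinearMap.mem_ker, ← Submodule.Quotient.mk_eq_zero (sSup c), Subtype.ext_iff]
      rfl
    have h2 : x ∈ LinearMap.ker q ↔ (x : M) ∈ N := Submodule.Quotient.mk_eq_zero _
    rw [h1, h2]
    exact ⟨fun h => hVN' ⟨x.2, h⟩, fun h => le_sSup hN h⟩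
  obtain ⟨j, hj⟩ := exists_factor hr q hker.le
  refine (H N hN).of_mono (i := j) ((injective_iff_map_eq_zero _).2 fun x hx => ?_)
  obtain ⟨x, rfl⟩ := hr x
  rw [hj] at hx
  exact hker.ge hx

end Local

/-! ### Finitely generated torsion submodules -/

section Noetherian

variable {S : Type u} [Ring S] {C : ModuleCat.{u} S}
  {Y M : Type u} [AddCommGroup Y] [Module S Y] [AddCommGroup M] [Module S M]

lemma HomZero.sup {V W : Submodule S M} (hV : HomZero V C) (hW : HomZero W C) :
    HomZero (V ⊔ W : Submodule S M) C := by
  intro f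
  ext ⟨x, hx⟩
  obtain ⟨v, hv, w, hw, rfl⟩ := Submodule.mem_sup.1 hx
  have h1 := LinearMap.congr_fun (hV (f ∘ₗ Submodule.inclusion le_sup_left)) ⟨v, hv⟩
  have h2 := LinearMap.congr_fun (hW (f ∘ₗ Submodule.inclusion le_sup_right)) ⟨w, hw⟩
  have h3 : (⟨v + w, hx⟩ : (V ⊔ W : Submodule S M)) =
    Submodule.inclusion le_sup_left ⟨v, hv⟩ + Submodule.inclusion le_sup_right ⟨w, hw⟩ := rfl
  rw [h3, map_add]
  exact (congrArg₂ (· + ·) h1 h2).trans (add_zero _)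

lemma fg_of_le_fg [IsNoetherianRing S] {V W : Submodule S M} (hW : W.FG) (h : V ≤ W) : V.FG := by
  have := isNoetherian_of_fg_of_noetherian W hW
  rw [← inf_eq_right.2 h, ← Submodule.map_comap_subtype]
  exact (IsNoetherian.noetherian _).map _

/-- A torsion module is the directed union of its finitely generated torsion submodules. -/
lemma IsOneCotilting.exists_fg_homZero_le [IsNoetherianRing S] (hC : IsOneCotilting C)
    (hCp : IsPureInjective C) (hM : HomZero M C) {U : Submodule S M} (hU : U.FG) :
    ∃ V : Submodule S M, V.FG ∧ HomZero V C ∧ U ≤ V := by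
  let c : Set (Submodule S M) := {V | V.FG ∧ HomZero V C}
  have hne : c.Nonempty := ⟨⊥, Submodule.fg_bot, fun f => by
    ext x
    rw [Subsingleton.elim x 0, map_zero, map_zero]⟩
  have hdir : DirectedOn (· ≤ ·) c := fun V hV W hW =>
    ⟨V ⊔ W, ⟨hV.1.sup hW.1, hV.2.sup hW.2⟩, le_sup_left, le_sup_right⟩
  have hcpt : ∀ W : Submodule S M, W.FG → W ≤ sSup c → ∃ V ∈ c, W ≤ V := fun W hW h =>
    (CompleteLattice.isCompactElement_iff_le_of_directed_sSup_le _ _).1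
      ((Submodule.fg_iff_compact _).1 hW) c hne hdir h
  let T := sSup c
  have hTF : ExtZero S (M ⧸ T) C := by
    refine extZero_of_forall_fg hCp fun P hP => hC.extZero_of_forall_exists fun m hm => ?_
    by_contra! hcon
    -- If `R`, the torsion part of `P`, is lifted to a finitely generated `V`, then `V ⊔ T₀` is an
    -- extension of `R` by `T₀` as soon as `T₀` contains `V ⊓ T`. It is thus torsion, so `V ≤ T` and
    -- `R = 0`.
    let R := (reject P C).map P.subtype
    have hRfg : R.FG := fg_of_le_fg hP (Submodule.map_subtype_le _ _)
    have hR : HomZero R C := hC.homZero_reject.of_surjective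
      (LinearMap.submoduleMap_surjective P.subtype (reject P C))
    obtain ⟨V, hV, hVR⟩ := exists_fg_map_eq T.mkQ_surjective hRfg
    obtain ⟨T₀, hT₀, hVT₀⟩ := hcpt (V ⊓ T) (fg_of_le_fg hV inf_le_left) inf_le_right
    have hVT : HomZero (V ⊔ T₀ : Submodule S M) C := by
      have hmap : ∀ x ∈ V ⊔ T₀, T.mkQ x ∈ R := by
        intro x hx
        obtain ⟨v, hv, w, hw, rfl⟩ := Submodule.mem_sup.1 hx
        have : T.mkQ w = 0 := (Submodule.Quotient.mk_eq_zero _).2 (le_sSup hT₀ hw)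
        rw [map_add, this, add_zero, ← hVR]
        exact Submodule.mem_map_of_mem hv
      refine HomZero.of_extension (i := Submodule.inclusion (le_sup_right : T₀ ≤ V ⊔ T₀))
        (p := T.mkQ.restrict hmap) hT₀.2 hR ?_ ?_
      · rintro ⟨y, hy⟩
        rw [← hVR] at hy
        obtain ⟨v, hv, rfl⟩ := hy
        exact ⟨⟨v, Submodule.mem_sup_left hv⟩, rfl⟩
      · rintro ⟨x, hx⟩ hxT
        obtain ⟨v, hv, w, hw, rfl⟩ := Submodule.mem_sup.1 hx
        have hxT' : v + w ∈ T := (Submodule.Quotient.mk_eq_zero _).1 (congrArg Subtype.val hxT)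
        have hvT : v ∈ T := (Submodule.add_mem_iff_left _ (le_sSup hT₀ hw)).1 hxT'
        exact ⟨⟨v + w, T₀.add_mem (hVT₀ ⟨hv, hvT⟩) hw⟩, rfl⟩
    have hVT' : V ≤ T := le_sup_left.trans (le_sSup (a := V ⊔ T₀) ⟨hV.sup hT₀.1, hVT⟩)
    have hmR : (m : M ⧸ T) ∈ R :=
      Submodule.mem_map_of_mem (f := P.subtype) ((Submodule.mem_iInf _).2 hcon)
    rw [← hVR] at hmR
    obtain ⟨v, hv, hvm⟩ := hmR
    apply hm
    rw [← Submodule.coe_eq_zero, ← hvm]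
    exact (Submodule.Quotient.mk_eq_zero _).2 (hVT' hv)
  have hT : T = ⊤ := by
    have := hC.subsingleton hTF (hM.of_surjective T.mkQ_surjective)
    exact Submodule.Quotient.subsingleton_iff.1 this
  obtain ⟨V, hV, hUV⟩ := hcpt U hU (hT ▸ le_top : U ≤ T)
  exact ⟨V, hV.1, hV.2, hUV⟩

end Noetherian

/-! ### The chain condition from `Σ`-pure-injectivity -/

section Chain

variable {S : Type u} [Ring S] {C : ModuleCat.{u} S}
  {Y M : Type u} [AddCommGroup Y] [Module S Y] [AddCommGroup M] [Module S M]

lemma exists_finset_support_subset {κ U : Type u} [AddCommGroup U] [Module S U]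
    [Module.Finite S M] (x : M →ₗ[S] κ →₀ U) : ∃ A : Finset κ, ∀ y, (x y).support ⊆ A := by
  classical
  obtain ⟨t, ht⟩ := (Module.finite_def.1 ‹_› : (⊤ : Submodule S M).FG)
  refine ⟨t.biUnion fun y => (x y).support, fun y => ?_⟩
  have hy : y ∈ Submodule.span S (t : Set M) := ht ▸ Submodule.mem_top
  induction hy using Submodule.span_induction with
  | mem y hy => exact Finset.subset_biUnion_of_mem (fun y => (x y).support) hy
  | zero => simp
  | add y z _ _ h1 h2 =>
    rw [map_add]
    exact Finsupp.support_add.trans (Finset.union_subset h1 h2)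
  | smul a y _ h =>
    rw [map_smul]
    exact Finsupp.support_smul.trans h

/-- For a `Σ`-pure-injective module, the embedding of a direct sum of copies into the direct
product splits. -/
lemma IsSigmaPureInjective.exists_retraction (hC : IsSigmaPureInjective C) (κ : Type u) :
    ∃ ρ : (κ → C) →ₗ[S] (κ →₀ C), ∀ z : κ →₀ C, ρ z = z := by
  classical
  let i : (κ →₀ C) →ₗ[S] (κ → C) := Finsupp.lcoeFun
  have hi : Function.Injective i := DFunLike.coe_injective
  have hex := i.exact_map_mkQ_range
  have hpure : IsPureExact (complexOf hex) := by
    refine ⟨complexOf_shortExact hi (Submodule.mkQ_surjective _) hex, fun F hF h => ?_⟩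
    have hF' : Module.FinitePresentation S F := hF
    obtain ⟨n, p, hp⟩ := Module.Finite.exists_fin' S F
    have hker : (LinearMap.ker p).FG := Module.FinitePresentation.fg_ker p hp
    have : Module.Finite S (LinearMap.ker p) := Module.Finite.iff_fg.2 hker
    obtain ⟨k, hk⟩ := Module.projective_lifting_property (LinearMap.range i).mkQ (h.hom ∘ₗ p)
      (Submodule.mkQ_surjective _)
    have hk' : ∀ x, Submodule.Quotient.mk (k x) = h.hom (p x) := fun x => LinearMap.congr_fun hk x
    have hmem : ∀ x : LinearMap.ker p, k x ∈ LinearMap.range i := fun x => by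
      rw [← Submodule.Quotient.mk_eq_zero, hk', LinearMap.mem_ker.1 x.2, map_zero]
    obtain ⟨A, hA⟩ := exists_finset_support_subset
      ((LinearEquiv.ofInjective i hi).symm.toLinearMap ∘ₗ
        (k ∘ₗ (LinearMap.ker p).subtype).codRestrict _ hmem)
    have hA' : ∀ x ∈ LinearMap.ker p, ∀ j ∉ A, k x j = 0 := by
      intro x hx j hj
      have h1 := congrArg Subtype.val ((LinearEquiv.ofInjective i hi).apply_symm_apply
        ⟨k x, hmem ⟨x, hx⟩⟩)
      refine (congrFun h1 j).symm.trans ?_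
      exact Finsupp.notMem_support_iff.1 fun h3 => hj (hA ⟨x, hx⟩ h3)
    -- The lift `k` sends the finitely generated kernel of `p` into finitely many coordinates `A`.
    -- Zeroing these does not change `k` modulo the direct sum, and makes it factor through `p`.
    let τ : (κ → C) →ₗ[S] (κ → C) := LinearMap.pi fun j => if j ∈ A then 0 else LinearMap.proj j
    have hτ : ∀ x j, τ x j = if j ∈ A then 0 else x j := by
      intro x j
      simp only [τ, LinearMap.pi_apply]
      split_ifs <;> rfl
    obtain ⟨q, hq⟩ := exists_factor hp (τ ∘ₗ k) fun x hx => by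
      rw [LinearMap.mem_ker]
      funext j
      rw [LinearMap.comp_apply, hτ]
      split_ifs with hj
      · rfl
      · exact hA' x hx j hj
    refine ⟨ModuleCat.ofHom q, ?_⟩
    ext y
    obtain ⟨x, rfl⟩ := hp y
    change Submodule.Quotient.mk (q (p x)) = h.hom (p x)
    rw [hq, ← hk', Submodule.Quotient.eq]
    refine ⟨Finsupp.onFinset A (fun j => τ (k x) j - k x j) fun j hj => ?_, rfl⟩
    by_contra hjA
    exact hj (by rw [hτ, if_neg hjA, sub_self])
  obtain ⟨ψ, hψ⟩ := hC κ _ hpure (𝟙 _)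
  exact ⟨ψ.hom, fun z => ConcreteCategory.congr_hom hψ z⟩

/-- A descending chain condition for `Σ`-pure-injective modules: if the restriction maps
`Hom(F n, C) → Hom(F 0, C)` along an ascending chain are injective, then one of the restriction
maps `Hom(F (n + 1), C) → Hom(F n, C)` is surjective. -/
lemma IsSigmaPureInjective.exists_forall_extends (hC : IsSigmaPureInjective C)
    {F : ℕ → Submodule S M} (hF : Monotone F) (hF0 : (F 0).FG)
    (H : ∀ n (f : F n →ₗ[S] C), f ∘ₗ Submodule.inclusion (hF (Nat.zero_le n)) = 0 → f = 0) :
    ∃ n, ∀ f : F n →ₗ[S] C, ∃ g : F (n + 1) →ₗ[S] C,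
      g ∘ₗ Submodule.inclusion (hF n.le_succ) = f := by
  classical
  by_contra! hcon
  choose f hf using hcon
  obtain ⟨ρ, hρ⟩ := hC.exists_retraction (ULift.{u} ℕ)
  let a : F 0 →ₗ[S] (ULift.{u} ℕ → C) :=
    LinearMap.pi fun j => f j.down ∘ₗ Submodule.inclusion (hF (Nat.zero_le _))
  have : Module.Finite S (F 0) := Module.Finite.iff_fg.2 hF0
  obtain ⟨A, hA⟩ := exists_finset_support_subset (ρ ∘ₗ a)
  -- Outside `A` the coordinate of `ρ ∘ a` vanishes; this index is the `n` where `f n` will be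
  -- extended.
  obtain ⟨j, hj⟩ := Infinite.exists_notMem_finset A
  have h0 : ∀ y, ρ (a y) j = 0 := fun y => Finsupp.notMem_support_iff.1 fun h => hj (hA y h)
  obtain ⟨n⟩ := j
  -- The tail of `a` from `n + 1` on is defined on all of `F (n + 1)`. On `F 0` it differs from `a`
  -- by a finitely supported vector, which `ρ` fixes; reading coordinate `n` gives `key`.
  let b : F (n + 1) →ₗ[S] (ULift.{u} ℕ → C) := LinearMap.pi fun j =>
    if h : n + 1 ≤ j.down then f j.down ∘ₗ Submodule.inclusion (hF h) else 0
  have hb : ∀ y j, n + 1 ≤ j.down →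
      b (Submodule.inclusion (hF (Nat.zero_le _)) y) j = a y j := by
    intro y j hj
    simp only [a, b, LinearMap.pi_apply, dif_pos hj]
    rfl
  have hbn : ∀ y, b y ⟨n⟩ = 0 := by
    intro y
    simp only [b, LinearMap.pi_apply]
    rw [dif_neg (Nat.not_succ_le_self n), LinearMap.zero_apply]
  have key : ∀ y, a y ⟨n⟩ = - ρ (b (Submodule.inclusion (hF (Nat.zero_le _)) y)) ⟨n⟩ := by
    intro y
    let y' := Submodule.inclusion (hF (Nat.zero_le (n + 1))) y
    let z : ULift.{u} ℕ →₀ C := Finsupp.onFinset ((Finset.range (n + 1)).image ULift.up)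
      (fun j => a y j - b y' j) fun j hj => by
        by_contra hj'
        have : n + 1 ≤ j.down := by
          by_contra hlt
          exact hj' (Finset.mem_image.2 ⟨j.down, Finset.mem_range.2 (not_le.1 hlt), rfl⟩)
        exact hj (by rw [hb y j this, sub_self])
    have hz : a y = (z : ULift.{u} ℕ → C) + b y' := by
      funext j
      exact (sub_add_cancel (a y j) (b y' j)).symm
    have h1 := h0 y
    have h2 : z ⟨n⟩ = a y ⟨n⟩ := by
      change a y ⟨n⟩ - b y' ⟨n⟩ = _
      rw [hbn, sub_zero]
    rw [hz, map_add, hρ, Finsupp.add_apply, h2] at h1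
    exact eq_neg_of_add_eq_zero_left h1
  let g : F (n + 1) →ₗ[S] C := -(Finsupp.lapply ⟨n⟩ ∘ₗ ρ ∘ₗ b)
  -- By `key`, `g` and `f n` agree on `F 0`, so by injectivity of restriction they agree on `F n`.
  refine hf n g (sub_eq_zero.1 (H n _ ?_))
  ext y
  have h1 : g (Submodule.inclusion (hF (Nat.zero_le (n + 1))) y) = a y ⟨n⟩ := (key y).symm
  exact sub_eq_zero.2 h1

end Chain

/-! ### Finitely generated submodules with torsion-free quotient -/

section Closure

variable {S : Type u} [Ring S] {C : ModuleCat.{u} S}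
  {Y M : Type u} [AddCommGroup Y] [Module S Y] [AddCommGroup M] [Module S M]

/-- Exactness of `Hom(M, U) → Hom(A, U) → Ext¹(P, U) → Ext¹(M, U)`: the lift on `M` is corrected by
an extended map so as to vanish on the image of `A`. -/
lemma ExtZero.of_extends {A P U : Type u} [AddCommGroup A] [Module S A] [AddCommGroup P]
    [Module S P] [AddCommGroup U] [Module S U] {i : A →ₗ[S] M} {p : M →ₗ[S] P}
    (hp : Function.Surjective p) (hip : Function.Exact i p) (H : ExtZero S M U)
    (hext : ∀ f : A →ₗ[S] U, ∃ g : M →ₗ[S] U, g ∘ₗ i = f) : ExtZero S P U := by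
  intro E Q _ _ _ _ f g hf hg hfg h
  obtain ⟨k, hk⟩ := H f g hf hg hfg (h ∘ₗ p)
  have hk' : ∀ x, g (k x) = h (p x) := LinearMap.congr_fun hk
  have hmem : ∀ a, k (i a) ∈ LinearMap.range f := fun a =>
    (hfg _).1 (by rw [hk', hip.apply_apply_eq_zero, map_zero])
  obtain ⟨c, hc⟩ := hext ((LinearEquiv.ofInjective f hf).symm.toLinearMap ∘ₗ
    (k ∘ₗ i).codRestrict _ hmem)
  have hc' : ∀ a, f (c (i a)) = k (i a) := by
    intro a
    have h1 : c (i a) = _ := LinearMap.congr_fun hc a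
    rw [h1]
    exact congrArg Subtype.val ((LinearEquiv.ofInjective f hf).apply_symm_apply ⟨_, hmem a⟩)
  obtain ⟨q, hq⟩ := exists_factor hp (k - f ∘ₗ c) fun x hx => by
    obtain ⟨a, rfl⟩ := (hip x).1 hx
    simp [hc']
  refine ⟨q, ?_⟩
  ext y
  obtain ⟨x, rfl⟩ := hp y
  simp [hq, hk', hfg.apply_apply_eq_zero]

/-- In a torsion-free module, every finitely generated submodule is contained in a finitely
generated submodule with torsion-free quotient. -/
lemma IsOneCotilting.exists_fg_extZero_quotient [IsNoetherianRing S] (hC : IsOneCotilting C)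
    (hCp : IsPureInjective C) (hCs : IsSigmaPureInjective C) (hM : ExtZero S M C)
    {F : Submodule S M} (hF : F.FG) :
    ∃ F' : Submodule S M, F'.FG ∧ F ≤ F' ∧ ExtZero S (M ⧸ F') C := by
  have := hC.injectiveDimension_le_one
  have hcomap : ∀ V : Submodule S (M ⧸ F), V.FG → (V.comap F.mkQ).FG := fun V hV =>
    Submodule.fg_of_fg_map_of_fg_inf_ker F.mkQ
      (by rwa [Submodule.map_comap_eq_of_surjective F.mkQ_surjective])
      (fg_of_le_fg hF (inf_le_right.trans_eq F.ker_mkQ))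
  let c : Set (Submodule S (M ⧸ F)) := {V | V.FG ∧ HomZero V C}
  -- Along the preimages `F n` of a strict chain of torsion submodules, some `Hom(F (n + 1), C) →
  -- Hom(F n, C)` is onto. Then `F (n + 1) / F n` is both torsion-free and torsion, hence zero,
  -- contradicting strictness.
  have hchain : ∀ V : ℕ → Submodule S (M ⧸ F), StrictMono V → ¬ ∀ n, V n ∈ c := by
    intro V hV hVc
    have hmono : Monotone fun n => (V n).comap F.mkQ := fun m n h =>
      Submodule.comap_mono (hV.monotone h)
    have H : ∀ n (f : (V n).comap F.mkQ →ₗ[S] C),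
        f ∘ₗ Submodule.inclusion (hmono (Nat.zero_le n)) = 0 → f = 0 := by
      intro n f hf
      have hp : Function.Surjective
          (F.mkQ.restrict (p := (V n).comap F.mkQ) (q := V n) fun _ h => h) := by
        rintro ⟨y, hy⟩
        obtain ⟨x, rfl⟩ := F.mkQ_surjective y
        exact ⟨⟨x, hy⟩, rfl⟩
      obtain ⟨q, hq⟩ := exists_factor hp f fun x hx => by
        have hx' : F.mkQ x = 0 := congrArg Subtype.val hx
        have hx0 : (x : M) ∈ (V 0).comap F.mkQ := by
          rw [Submodule.mem_comap, hx']
          exact zero_mem _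
        exact LinearMap.congr_fun hf ⟨x, hx0⟩
      ext x
      rw [← hq, (hVc n).2 q]
      rfl
    obtain ⟨n, hn⟩ := hCs.exists_forall_extends hmono (hcomap _ (hVc 0).1) H
    let N := ((V n).comap F.mkQ).submoduleOf ((V (n + 1)).comap F.mkQ)
    have hP : ExtZero S (_ ⧸ N) C := by
      refine ExtZero.of_extends N.mkQ_surjective ?_
        (hM.of_mono (Submodule.injective_subtype _)) hn
      intro x
      constructor
      · intro hx
        have hx' : x ∈ N := (Submodule.Quotient.mk_eq_zero N).1 hx
        exact ⟨⟨x, hx'⟩, rfl⟩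
      · rintro ⟨y, rfl⟩
        exact (Submodule.Quotient.mk_eq_zero _).2 y.2
    have hP' : HomZero (_ ⧸ N) C := by
      intro f
      have h1 := H (n + 1) (f ∘ₗ N.mkQ) (by
        ext y
        have : N.mkQ (Submodule.inclusion (hmono (Nat.zero_le (n + 1))) y) = 0 :=
          (Submodule.Quotient.mk_eq_zero _).2 (hmono (Nat.zero_le n) y.2)
        rw [LinearMap.comp_apply, LinearMap.comp_apply, this, map_zero, LinearMap.zero_apply])
      ext x
      exact LinearMap.congr_fun h1 x
    have := hC.subsingleton hP hP'
    refine (hV n.lt_succ_self).not_ge fun y hy => ?_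
    obtain ⟨x, rfl⟩ := F.mkQ_surjective y
    exact (Submodule.Quotient.mk_eq_zero N (x := ⟨x, hy⟩)).1 (Subsingleton.elim _ _)
  obtain ⟨V₀, hV₀, hmax⟩ : ∃ V₀ ∈ c, ∀ V ∈ c, ¬ V₀ < V := by
    by_contra! hcon
    have : NoMaxOrder c := ⟨fun V => by
      obtain ⟨W, hW, h⟩ := hcon V V.2
      exact ⟨⟨W, hW⟩, h⟩⟩
    have : Nonempty c := ⟨⟨⊥, Submodule.fg_bot, fun f => by
      ext x
      rw [Subsingleton.elim x 0, map_zero, map_zero]⟩⟩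
    obtain ⟨V, hV⟩ := Nat.exists_strictMono c
    exact hchain (fun n => V n) hV fun n => (V n).2
  let X := reject (M ⧸ F) C
  -- Maximality of `V₀` absorbs every finitely generated torsion submodule, and these exhaust `X`;
  -- so `X` is finitely generated.
  have hX : X ≤ V₀ := by
    intro x hx
    obtain ⟨V, hV, hV', hle⟩ := hC.exists_fg_homZero_le hCp hC.homZero_reject
      (Submodule.fg_span_singleton (⟨x, hx⟩ : X))
    have hW : V.map X.subtype ∈ c :=
      ⟨hV.map _, hV'.of_surjective (LinearMap.submoduleMap_surjective _ _)⟩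
    have hsup : V₀ ⊔ V.map X.subtype ∈ c := ⟨hV₀.1.sup hW.1, hV₀.2.sup hW.2⟩
    have heq : V₀ = V₀ ⊔ V.map X.subtype := by
      by_contra hne
      exact hmax _ hsup (lt_of_le_of_ne le_sup_left hne)
    rw [heq]
    exact Submodule.mem_sup_right ⟨_, hle (Submodule.mem_span_singleton_self _), rfl⟩
  refine ⟨X.comap F.mkQ, hcomap X (fg_of_le_fg hV₀.1 hX), fun x hx => ?_, ?_⟩
  · rw [Submodule.mem_comap, Submodule.mkQ_apply, (Submodule.Quotient.mk_eq_zero F).2 hx]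
    exact zero_mem _
  · refine hC.extZero_quotient_reject.of_mono (i := (X.comap F.mkQ).mapQ X F.mkQ le_rfl) ?_
    rw [injective_iff_map_eq_zero]
    intro x hx
    obtain ⟨x, rfl⟩ := Submodule.mkQ_surjective _ x
    have hx' : F.mkQ x ∈ X := (Submodule.Quotient.mk_eq_zero X).1 hx
    exact (Submodule.Quotient.mk_eq_zero _).2 hx'

end Closure

/-! ### Reduction to finitely generated modules and the two equivalences -/

section Main

variable {S : Type u} [Ring S] {C : ModuleCat.{u} S}
  {Y M : Type u} [AddCommGroup Y] [Module S Y] [AddCommGroup M] [Module S M]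

lemma IsSigmaPureInjective.isPureInjective (hC : IsSigmaPureInjective C) : IsPureInjective C := by
  intro E hE φ
  obtain ⟨ψ, hψ⟩ := hC PUnit E hE (φ ≫ ModuleCat.ofHom (Finsupp.lsingle PUnit.unit))
  refine ⟨ψ ≫ ModuleCat.ofHom (Finsupp.lapply PUnit.unit), ?_⟩
  rw [← Category.assoc, hψ]
  ext x
  simp

/-- A module `N` with `Ext¹(P, N) = 0` for all finitely generated torsion-free `P` satisfies
`Ext¹(M, N) = 0` for all torsion-free `M`. -/
theorem IsOneCotilting.extZero_of_forall_finite [IsNoetherianRing S] (hC : IsOneCotilting C)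
    (hCs : IsSigmaPureInjective C) {N : Type u} [AddCommGroup N] [Module S N]
    (H : ∀ (P : Type u) [AddCommGroup P] [Module S P], Module.Finite S P → ExtZero S P C →
      ExtZero S P N) (hM : ExtZero S M C) : ExtZero S M N := by
  have := hC.injectiveDimension_le_one
  have hCp := hCs.isPureInjective
  obtain ⟨I, Q, _, _, _, _, f, g, hI, hf, hg, hfg⟩ := exists_injective_embedding S N
  refine extZero_of_injective hf hfg fun h => ?_
  -- Zorn is applied to partial lifts of `h`. Requiring a torsion-free quotient by the domain is
  -- what allows a non-total lift to be extended further.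
  let c : Set (M →ₗ.[S] I) := {k | (∀ x : k.domain, g (k x) = h x) ∧ ExtZero S (M ⧸ k.domain) C}
  have hbot : (⊥ : M →ₗ.[S] I) ∈ c := by
    refine ⟨fun x => ?_, hM.of_linearEquiv (Submodule.quotEquivOfEqBot _ rfl).symm⟩
    have hx : x = 0 := Subsingleton.elim (α := (⊥ : Submodule S M)) x 0
    rw [hx]
    simp
  obtain ⟨k, -, hk⟩ := zorn_le_nonempty₀ c (fun d hd hchain k₀ hk₀ => by
    have hdir := hchain.directedOn
    refine ⟨LinearPMap.sSup d hdir, ⟨fun ⟨x, hx⟩ => ?_, ?_⟩, fun k hk => LinearPMap.le_sSup hdir hk⟩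
    · obtain ⟨k, hk, hxk⟩ := (LinearPMap.mem_domain_sSup_iff ⟨k₀, hk₀⟩ hdir).1 hx
      have := LinearPMap.sSup_apply hdir hk ⟨x, hxk⟩
      exact (congrArg g this).trans ((hd hk).1 ⟨x, hxk⟩)
    · rw [LinearPMap.domain_sSup]
      refine extZero_quotient_sSup hCp ⟨_, k₀, hk₀, rfl⟩ ?_ ?_
      · exact directedOn_image.2 (hdir.mono fun _ _ h => LinearPMap.domain_mono.monotone h)
      · rintro _ ⟨k, hk, rfl⟩
        exact (hd hk).2) ⊥ hbot
  have htop : k.domain = ⊤ := by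
    by_contra hne
    obtain ⟨y, -, hy⟩ := SetLike.exists_of_lt (lt_top_iff_ne_top.2 hne)
    let D := k.domain
    obtain ⟨F', hF', hle, hquot⟩ := hC.exists_fg_extZero_quotient hCp hCs hk.prop.2
      (Submodule.fg_span_singleton (D.mkQ y))
    let D' := F'.comap D.mkQ
    have hDD' : D ≤ D' := fun x hx => by
      rw [Submodule.mem_comap, Submodule.mkQ_apply, (Submodule.Quotient.mk_eq_zero D).2 hx]
      exact zero_mem _
    -- `F'` is isomorphic to `D' / D`, so this is the vanishing needed to extend the lift from `D`
    -- to `D'`.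
    have hF'N : ExtZero S F' N := H F' (Module.Finite.iff_fg.2 hF')
      (hk.prop.2.of_mono (Submodule.injective_subtype _))
    obtain ⟨l, hl, hlk⟩ := hF'N.exists_extend hf hg hfg (i := Submodule.inclusion hDD')
      (p := D.mkQ.restrict (p := D') (q := F') fun _ h => h) (Submodule.inclusion_injective hDD')
      (by
        rintro ⟨z, hz⟩
        obtain ⟨x, rfl⟩ := D.mkQ_surjective z
        exact ⟨⟨x, hz⟩, rfl⟩)
      (by
        intro x
        constructor
        · intro hx
          have hx' : (x : M) ∈ D := (Submodule.Quotient.mk_eq_zero D).1 (congrArg Subtype.val hx)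
          exact ⟨⟨x, hx'⟩, rfl⟩
        · rintro ⟨z, rfl⟩
          exact Subtype.ext ((Submodule.Quotient.mk_eq_zero D).2 z.2))
      (h ∘ₗ D'.subtype) k.toFun (by
        ext x
        exact hk.prop.1 x)
    have hmem : (⟨D', l⟩ : M →ₗ.[S] I) ∈ c := by
      refine ⟨fun x => LinearMap.congr_fun hl x, ?_⟩
      refine hquot.of_mono (i := D'.mapQ F' D.mkQ le_rfl) ?_
      rw [injective_iff_map_eq_zero]
      intro x hx
      obtain ⟨x, rfl⟩ := Submodule.mkQ_surjective _ x
      have hx' : D.mkQ x ∈ F' := (Submodule.Quotient.mk_eq_zero F').1 hx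
      exact (Submodule.Quotient.mk_eq_zero _).2 hx'
    have hkl : k ≤ ⟨D', l⟩ := by
      refine ⟨hDD', fun x z hxz => ?_⟩
      have hz : z = Submodule.inclusion hDD' x := Subtype.ext hxz.symm
      rw [hz]
      exact (LinearMap.congr_fun hlk x).symm
    exact hy ((hk.le_of_ge hmem hkl).1 (hle (Submodule.mem_span_singleton_self _) : y ∈ D'))
  refine ⟨k.toFun ∘ₗ LinearMap.id.codRestrict k.domain fun x => htop ▸ Submodule.mem_top, ?_⟩
  ext x
  exact hk.prop.1 _

lemma IsOneCotilting.extZero_of_splitsIn (hC : IsOneCotilting C)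
    (hs : SplitsIn (finitelyGenerated S) (leftHomPerp (leftExtPerp C) ⊓ finitelyGenerated S)
      (leftExtPerp C ⊓ finitelyGenerated S)) {X : Type u} [AddCommGroup X] [Module S X]
    [Module.Finite S Y] [Module.Finite S X] (hY : ExtZero S Y C) (hX : HomZero X C) :
    ExtZero S Y X := by
  refine extZero_of_splits fun E _ _ f g hf hg hfg => ?_
  have hE : Module.Finite S E := by
    refine ⟨Submodule.fg_of_fg_map_of_fg_inf_ker g ?_ ?_⟩
    · rw [Submodule.map_top, LinearMap.range_eq_top.2 hg]
      exact Module.Finite.fg_top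
    · rw [top_inf_eq, hfg.linearMap_ker_eq]
      exact Submodule.fg_range f
  obtain ⟨X', Y', hXY, hX', hY'⟩ := hs (ModuleCat.of S E) hE
  have hX'' : HomZero X' C := (hC.leftHomPerp_iff _).1 hX'.1
  have hY'' : ExtZero S Y' C := (subsingleton_ext_iff _ _).1 hY'.1
  -- There are no nonzero maps from torsion to torsion-free modules, so `g` kills `X'` and `f` lands
  -- in `X'`. Hence `g` maps `Y'` isomorphically onto `Y`, and the inverse is a section.
  have h1 : ∀ x : X', g x = 0 := LinearMap.congr_fun (hX''.eq_zero hC hY (g ∘ₗ X'.subtype))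
  have h2 : ∀ x : X, f x ∈ X' := fun x => by
    have := LinearMap.congr_fun (hX.eq_zero hC hY'' (Y'.projectionOnto X' hXY.symm ∘ₗ f)) x
    simpa using this
  let e : Y' →ₗ[S] Y := g ∘ₗ Y'.subtype
  have he : Function.Bijective e := by
    constructor
    · rw [injective_iff_map_eq_zero]
      intro y hy
      obtain ⟨x, hx⟩ := (hfg _).1 hy
      have : (y : E) ∈ X' := by
        have := h2 x
        rwa [hx] at this
      exact Subtype.ext (Submodule.disjoint_def.1 hXY.disjoint _ this y.2)
    · intro y
      obtain ⟨z, rfl⟩ := hg y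
      obtain ⟨a, ha, b, hb, rfl⟩ := Submodule.mem_sup.1
        (hXY.sup_eq_top ▸ Submodule.mem_top : z ∈ X' ⊔ Y')
      refine ⟨⟨b, hb⟩, ?_⟩
      rw [map_add, h1 ⟨a, ha⟩, zero_add]
      rfl
  refine ⟨Y'.subtype ∘ₗ (LinearEquiv.ofBijective e he).symm.toLinearMap, ?_⟩
  ext y
  exact (LinearEquiv.ofBijective e he).apply_symm_apply y

/-- Each extension of `Y` by `X` contains an extension of `Y` by a finitely generated torsion `T ≤
X`: take a finitely generated `V` mapping onto `Y` and `T` containing `V ∩ X`. A section of `V + T →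
Y` is a section of the whole. -/
lemma IsOneCotilting.extZero_of_forall_homZero_finite [IsNoetherianRing S] (hC : IsOneCotilting C)
    (hCp : IsPureInjective C) {X : Type u} [AddCommGroup X] [Module S X] [Module.Finite S Y]
    (H : ∀ T : Submodule S X, T.FG → HomZero T C → ExtZero S Y T) (hX : HomZero X C) :
    ExtZero S Y X := by
  refine extZero_of_splits fun E _ _ f g hf hg hfg => ?_
  obtain ⟨V, hV, hVg⟩ := exists_fg_map_eq hg (Module.Finite.fg_top (R := S) (M := Y))
  have hU : (V.comap f).FG := by
    apply Submodule.fg_of_fg_map_injective f hf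
    exact fg_of_le_fg hV (Submodule.map_comap_le _ _)
  obtain ⟨T, hT, hT', hUT⟩ := hC.exists_fg_homZero_le hCp hX hU
  let E₁ := V ⊔ T.map f
  have hmem : ∀ t ∈ T, f t ∈ E₁ := fun t ht => Submodule.mem_sup_right ⟨t, ht, rfl⟩
  obtain ⟨s, hs⟩ := H T hT hT' (f.restrict hmem) (g ∘ₗ E₁.subtype)
    (fun a b hab => Subtype.ext (hf (congrArg Subtype.val hab)))
    (fun y => by
      obtain ⟨v, hv, rfl⟩ := (hVg ▸ Submodule.mem_top : y ∈ V.map g)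
      exact ⟨⟨v, Submodule.mem_sup_left hv⟩, rfl⟩)
    (by
      rintro ⟨x, hx⟩
      constructor
      · intro h0
        obtain ⟨v, hv, _, ⟨t, ht, rfl⟩, rfl⟩ := Submodule.mem_sup.1 hx
        have hgv : g v = 0 := by
          have : g (v + f t) = 0 := h0
          rwa [map_add, hfg.apply_apply_eq_zero, add_zero] at this
        obtain ⟨x, rfl⟩ := (hfg v).1 hgv
        exact ⟨⟨x + t, T.add_mem (hUT hv) ht⟩, Subtype.ext (map_add f x t)⟩
      · rintro ⟨t, ht⟩
        rw [← ht]
        exact hfg.apply_apply_eq_zero _) LinearMap.id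
  exact ⟨E₁.subtype ∘ₗ s, hs⟩

lemma IsOneCotilting.splitsIn_top (hC : IsOneCotilting C)
    (H : ∀ (X Y : Type u) [AddCommGroup X] [Module S X] [AddCommGroup Y] [Module S Y],
      HomZero X C → ExtZero S Y C → ExtZero S Y X) :
    SplitsIn ⊤ (leftHomPerp (leftExtPerp C)) (leftExtPerp C) := by
  intro M _
  let X := reject M C
  obtain ⟨s, hs⟩ := H X (M ⧸ X) hC.homZero_reject hC.extZero_quotient_reject X.subtype X.mkQ
    (Submodule.injective_subtype _) X.mkQ_surjective (LinearMap.exact_subtype_mkQ X) LinearMap.id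
  have hs' : ∀ y, X.mkQ (s y) = y := LinearMap.congr_fun hs
  refine ⟨X, LinearMap.range s, ⟨?_, ?_⟩, (hC.leftHomPerp_iff _).2 hC.homZero_reject,
    (subsingleton_ext_iff _ _).2 ?_⟩
  · rw [Submodule.disjoint_def]
    rintro _ hx ⟨y, rfl⟩
    rw [← hs' y, Submodule.mkQ_apply, (Submodule.Quotient.mk_eq_zero X).2 hx, map_zero]
  · rw [codisjoint_iff, eq_top_iff]
    intro m _
    refine Submodule.mem_sup.2 ⟨m - s (X.mkQ m), ?_, s (X.mkQ m), ⟨_, rfl⟩, sub_add_cancel _ _⟩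
    rw [← Submodule.Quotient.mk_eq_zero, ← Submodule.mkQ_apply, map_sub, hs', sub_self]
  · exact hC.extZero_quotient_reject.of_linearEquiv
      (LinearEquiv.ofInjective s (Function.LeftInverse.injective hs'))

theorem IsOneCotilting.splitsIn_iff [IsNoetherianRing S] (hC : IsOneCotilting C)
    (hCs : IsSigmaPureInjective C) :
    SplitsIn (finitelyGenerated S) (leftHomPerp (leftExtPerp C) ⊓ finitelyGenerated S)
      (leftExtPerp C ⊓ finitelyGenerated S) ↔
    SplitsIn ⊤ (leftHomPerp (leftExtPerp C)) (leftExtPerp C) := by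
  constructor
  · intro hs
    refine hC.splitsIn_top fun X Y _ _ _ _ hX hY => ?_
    refine hC.extZero_of_forall_finite hCs (fun P _ _ _ hP => ?_) hY
    refine hC.extZero_of_forall_homZero_finite hCs.isPureInjective (fun T hT hT' => ?_) hX
    have : Module.Finite S T := Module.Finite.iff_fg.2 hT
    exact hC.extZero_of_splitsIn hs hP hT'
  · intro hs M hM
    obtain ⟨X, Y, h, hX, hY⟩ := hs M trivial
    have : Module.Finite S M := hM
    exact ⟨X, Y, h, ⟨hX, inferInstanceAs (Module.Finite S X)⟩,
      ⟨hY, inferInstanceAs (Module.Finite S Y)⟩⟩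

theorem IsOneCotilting.projDimLEOne_iff [IsNoetherianRing S] (hC : IsOneCotilting C)
    (hCs : IsSigmaPureInjective C) :
    ProjDimLEOne (leftExtPerp C ⊓ finitelyGenerated S) ↔ ProjDimLEOne (leftExtPerp C) := by
  constructor
  · intro H M hM
    rw [hasProjectiveDimensionLE_one_iff]
    intro N I Q _ _ _ _ _ _ f g hI hf hg hfg
    refine hC.extZero_of_forall_finite hCs (fun P _ _ hP hP' => ?_)
      ((subsingleton_ext_iff _ _).1 hM)
    exact (hasProjectiveDimensionLE_one_iff (ModuleCat.of S P)).1
      (H _ ⟨(subsingleton_ext_iff _ _).2 hP', hP⟩) N I Q f g hI hf hg hfg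
  · exact fun H M hM => H M hM.1

end Main

end CotiltingTheory

/-- Right `R`-modules are the objects of `ModuleCat Rᵐᵒᵖ`, and `R` is right noetherian if and only
if `Rᵐᵒᵖ` is left noetherian. -/
theorem mainTheorem8 (R : Type u) [Ring R] [IsNoetherianRing Rᵐᵒᵖ] (C : ModuleCat.{u} Rᵐᵒᵖ)
    (hC : CotiltingTheory.IsOneCotilting C) (hCpure : CotiltingTheory.IsSigmaPureInjective C)
    (𝒳 𝒴 𝒳₀ 𝒴₀ : ObjectProperty (ModuleCat.{u} Rᵐᵒᵖ))
    (h𝒴 : 𝒴 = CotiltingTheory.leftExtPerp C)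
    (h𝒳 : 𝒳 = CotiltingTheory.leftHomPerp 𝒴)
    (h𝒳₀ : 𝒳₀ = 𝒳 ⊓ CotiltingTheory.finitelyGenerated Rᵐᵒᵖ)
    (h𝒴₀ : 𝒴₀ = 𝒴 ⊓ CotiltingTheory.finitelyGenerated Rᵐᵒᵖ) :
    (CotiltingTheory.SplitsIn (CotiltingTheory.finitelyGenerated Rᵐᵒᵖ) 𝒳₀ 𝒴₀ ↔
      CotiltingTheory.SplitsIn ⊤ 𝒳 𝒴) ∧
    (CotiltingTheory.ProjDimLEOne 𝒴₀ ↔ CotiltingTheory.ProjDimLEOne 𝒴) := by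
  subst h𝒳₀ h𝒴₀ h𝒳 h𝒴
  exact ⟨hC.splitsIn_iff hCpure, hC.projDimLEOne_iff hCpure⟩
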